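/- Throughout, algebras are associative unital algebras over $\mathbb{C}$. An Arens-Michael algebra is a complete Hausdorff topological algebra whose topology is generated by a family of submultiplicative seminorms. The Arens-Michael envelope of an algebra $A$ is a pair $(\widehat A,\iota)$, where $\widehat A$ is an Arens-Michael algebra and $\iota:A\to\widehat A$ is a homomorphism that is continuous for the strongest locally convex topology on $A$, such that for every Arens-Michael algebra $B$ and every homomorphism $\varphi:A\to B$ continuous for that topology there is a unique continuous homomorphism $\widehat\varphi:\widehat A\to B$ with $\widehat\varphi\circ\iota=\varphi$. **Theorem.** Let $\Lambda_2=\mathbb{C}\langle x,y\rangle/(yx-xy-y^2)$ be the Jordanian plane, and let $$\widehat\Lambda_2=\Big\{a=\sum_{i,j=0}^\infty a_{ij}x^iy^j \;:\; a_{ij}\in\mathbb{C},\ \|a\|_\rho<\infty\ \text{for all}\ \rho>0\Big\},\qquad \|a\|_\rho=\sum_{i,j=0}^\infty |a_{ij}|\,\frac{\rho^{i+j}}{j!},$$ with the locally convex topology generated by the seminorms $\|\cdot\|_\rho$, $\rho>0$. There is exactly one separately continuous multiplication that makes the vector space $\widehat\Lambda_2$ an algebra in which each monomial $x^iy^j$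 is the product of the $i$-th power of $x$ and the $j$-th power of $y$, and in which $yx=xy+y^2$. With this multiplication, every $a\in\widehat\Lambda_2$ is the sum of the convergent series $\sum_{i,j} a_{ij}x^iy^j$, and $\widehat\Lambda_2$, together with the homomorphism $\Lambda_2\to\widehat\Lambda_2$ sending $x\mapsto x$ and $y\mapsto y$, is the Arens-Michael envelope of $\Lambda_2$. -/

import Mathlib

/-! ### Arens-Michael algebras and Arens-Michael envelopes -/

/-- An Arens-Michael algebra: a complete Hausdorff topological (unital, associative) complex
algebra whose topology is generated by a family of submultiplicative seminorms. -/
structure IsArensMichaelAlgebra (B : Type*) [Ring B] [Algebra ℂ B] [TopologicalSpace B] :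
    Prop where
  isTopologicalAddGroup : IsTopologicalAddGroup B
  t2Space : T2Space B
  /-- Completeness is with respect to the canonical uniformity of the additive group `B`. -/
  completeSpace : @CompleteSpace B (IsTopologicalAddGroup.rightUniformSpace B)
  exists_seminorms : ∃ P : Set (Seminorm ℂ B),
    (∀ p ∈ P, ∀ a b : B, p (a * b) ≤ p a * p b) ∧
      WithSeminorms (fun p : P => (p : Seminorm ℂ B))

/-- The pair `(E, ι)` is the Arens-Michael envelope of the algebra `A` with its given topology:
every continuous homomorphism from `A` to an Arens-Michael algebra factors uniquely through
`ι` by a continuous homomorphism. -/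
structure IsTopArensMichaelEnvelope.{u, v, w} {A : Type v} [Ring A] [Algebra ℂ A]
    [TopologicalSpace A] {E : Type w} [Ring E] [Algebra ℂ E] [TopologicalSpace E]
    (ι : A →ₐ[ℂ] E) : Prop where
  isArensMichaelAlgebra : IsArensMichaelAlgebra E
  continuous : Continuous ι
  existsUnique_lift : ∀ (B : Type u) [Ring B] [Algebra ℂ B] [TopologicalSpace B],
    IsArensMichaelAlgebra B → ∀ φ : A →ₐ[ℂ] B, Continuous φ →
      ∃! ψ : E →ₐ[ℂ] B, Continuous ψ ∧ ψ.comp ι = φ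

/-- The strongest locally convex topology on a complex vector space: the supremum of all locally
convex vector space topologies (in Lean's order, finer topologies are smaller). -/
@[reducible]
def strongestLocallyConvexTopology (V : Type*) [AddCommGroup V] [Module ℂ V] :
    TopologicalSpace V :=
  sInf {t : TopologicalSpace V | @IsTopologicalAddGroup V t _ ∧ @ContinuousSMul ℂ V _ _ t ∧
    @LocallyConvexSpace ℝ V _ _ _ _ t}

/-- The pair `(E, ι)` is the Arens-Michael envelope of the algebra `A` (without a topology):
the envelope of `A` endowed with the strongest locally convex topology. -/
def IsArensMichaelEnvelope.{u, v, w} {A : Type v} [Ring A] [Algebra ℂ A]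
    {E : Type w} [Ring E] [Algebra ℂ E] [TopologicalSpace E] (ι : A →ₐ[ℂ] E) : Prop :=
  letI : TopologicalSpace A := strongestLocallyConvexTopology A
  IsTopArensMichaelEnvelope.{u, v, w} ι

/-! ### The Jordanian plane -/

/-- The defining relation `yx - xy - y² = 0`, where `x` and `y` are the free generators
`0` and `1`. -/
inductive JordanianRel : FreeAlgebra ℂ (Fin 2) → FreeAlgebra ℂ (Fin 2) → Prop
  | rel : JordanianRel
      (FreeAlgebra.ι ℂ 1 * FreeAlgebra.ι ℂ 0 - FreeAlgebra.ι ℂ 0 * FreeAlgebra.ι ℂ 1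
        - FreeAlgebra.ι ℂ 1 ^ 2) 0

/-- The Jordanian plane `ℂ⟨x, y⟩ / (yx - xy - y²)`. -/
abbrev JordanianPlane : Type := RingQuot JordanianRel

namespace JordanianPlane

/-- The generator `x`. -/
noncomputable def x : JordanianPlane :=
  RingQuot.mkAlgHom ℂ JordanianRel (FreeAlgebra.ι ℂ 0)

/-- The generator `y`. -/
noncomputable def y : JordanianPlane :=
  RingQuot.mkAlgHom ℂ JordanianRel (FreeAlgebra.ι ℂ 1)

end JordanianPlane

/-! ### The space of power series -/

/-- The weighted absolute value `|a_{ij}| ρ^{i+j} / j!` of the coefficient of index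
`n = (i, j)`. -/
noncomputable def jordanianTerm (ρ : ℝ) (a : ℕ × ℕ → ℂ) (n : ℕ × ℕ) : ℝ :=
  ‖a n‖ * (ρ ^ (n.1 + n.2) / (n.2.factorial : ℝ))

theorem jordanianTerm_nonneg {ρ : ℝ} (hρ : 0 < ρ) (a : ℕ × ℕ → ℂ) (n : ℕ × ℕ) :
    0 ≤ jordanianTerm ρ a n := by
  unfold jordanianTerm; positivity

theorem jordanianTerm_add_le {ρ : ℝ} (hρ : 0 < ρ) (a b : ℕ × ℕ → ℂ) (n : ℕ × ℕ) :
    jordanianTerm ρ (a + b) n ≤ jordanianTerm ρ a n + jordanianTerm ρ b n := by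
  unfold jordanianTerm
  rw [← add_mul]
  exact mul_le_mul_of_nonneg_right (norm_add_le _ _) (by positivity)

theorem jordanianTerm_smul (ρ : ℝ) (c : ℂ) (a : ℕ × ℕ → ℂ) (n : ℕ × ℕ) :
    jordanianTerm ρ (c • a) n = ‖c‖ * jordanianTerm ρ a n := by
  simp [jordanianTerm, mul_assoc]

/-- The families of coefficients `(a_{ij})` with `∑ |a_{ij}| ρ^{i+j} / j! < ∞` for all
`ρ > 0`. -/
noncomputable def jordanianSubmodule : Submodule ℂ (ℕ × ℕ → ℂ) where
  carrier := {a | ∀ ρ : ℝ, 0 < ρ → Summable (jordanianTerm ρ a)}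
  add_mem' := fun {a b} ha hb ρ hρ =>
    Summable.of_nonneg_of_le (jordanianTerm_nonneg hρ _) (jordanianTerm_add_le hρ a b)
      ((ha ρ hρ).add (hb ρ hρ))
  zero_mem' := fun ρ _ => by
    have h : jordanianTerm ρ 0 = 0 := by ext n; simp [jordanianTerm]
    rw [h]; exact summable_zero
  smul_mem' := fun c a ha ρ hρ => by
    have h : jordanianTerm ρ (c • a) = fun n => ‖c‖ * jordanianTerm ρ a n :=
      funext (jordanianTerm_smul ρ c a)
    rw [h]; exact (ha ρ hρ).mul_left _

/-- The vector space of power series `∑ a_{ij} xⁱ yʲ` with `∑ |a_{ij}| ρ^{i+j} / j! < ∞` for all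
`ρ > 0`. It is not an abbreviation, so that it does not inherit the product topology. -/
def JordanianSeries : Type := jordanianSubmodule

namespace JordanianSeries

noncomputable instance : AddCommGroup JordanianSeries :=
  inferInstanceAs (AddCommGroup jordanianSubmodule)

noncomputable instance : Module ℂ JordanianSeries :=
  inferInstanceAs (Module ℂ jordanianSubmodule)

/-- The coefficients `a_{ij}` of a power series. -/
def coeff (a : JordanianSeries) : ℕ × ℕ → ℂ := a.1

/-- The seminorm `‖a‖_ρ = ∑ |a_{ij}| ρ^{i+j} / j!` for `ρ > 0`. -/
noncomputable def seminorm (ρ : Set.Ioi (0 : ℝ)) : Seminorm ℂ JordanianSeries :=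
  Seminorm.of (fun a => ∑' n, jordanianTerm ρ a.coeff n)
    (fun a b => by
      have ha : Summable (jordanianTerm ρ a.coeff) := a.2 ρ ρ.2
      have hb : Summable (jordanianTerm ρ b.coeff) := b.2 ρ ρ.2
      rw [← ha.tsum_add hb]
      exact Summable.tsum_le_tsum (jordanianTerm_add_le ρ.2 a.coeff b.coeff)
        ((a + b).2 ρ ρ.2) (ha.add hb))
    (fun c a => by
      rw [← tsum_mul_left]
      exact tsum_congr (jordanianTerm_smul ρ c a.coeff))

/-- The topology generated by the seminorms `‖·‖_ρ`, `ρ > 0`. -/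
noncomputable instance : TopologicalSpace JordanianSeries :=
  (SeminormFamily.moduleFilterBasis (𝕜 := ℂ) seminorm).topology

theorem withSeminorms : WithSeminorms seminorm := ⟨rfl⟩

/-- The series with coefficient `1` at `(i, j)` and `0` elsewhere, that is, the monomial
`xⁱ yʲ`. -/
noncomputable def monomial (i j : ℕ) : JordanianSeries :=
  ⟨Pi.single (i, j) 1, fun ρ _ =>
    summable_of_ne_finset_zero (s := {(i, j)}) fun n hn => by
      have h : n ≠ (i, j) := by simpa using hn
      simp [jordanianTerm, Pi.single_eq_of_ne h]⟩

end JordanianSeries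

/-! ### Multiplications on a vector space -/

/-- A structure of unital associative complex algebra on a given vector space. -/
@[ext]
structure AlgebraStructure (V : Type*) [AddCommGroup V] [Module ℂ V] where
  mul : V →ₗ[ℂ] V →ₗ[ℂ] V
  one : V
  mul_assoc : ∀ a b c, mul (mul a b) c = mul a (mul b c)
  one_mul : ∀ a, mul one a = a
  mul_one : ∀ a, mul a one = a

namespace AlgebraStructure

variable {V : Type*} [AddCommGroup V] [Module ℂ V]

/-- The space `V` regarded as an algebra with the multiplication `m`. -/
def Carrier (_m : AlgebraStructure V) : Type _ := V

instance (m : AlgebraStructure V) : AddCommGroup m.Carrier := inferInstanceAs (AddCommGroup V)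

instance (m : AlgebraStructure V) : Module ℂ m.Carrier := inferInstanceAs (Module ℂ V)

instance (m : AlgebraStructure V) [TopologicalSpace V] : TopologicalSpace m.Carrier :=
  inferInstanceAs (TopologicalSpace V)

instance (m : AlgebraStructure V) : Ring m.Carrier :=
  { (inferInstance : AddCommGroup m.Carrier) with
    mul := fun a b => m.mul a b
    one := m.one
    mul_assoc := m.mul_assoc
    one_mul := m.one_mul
    mul_one := m.mul_one
    left_distrib := fun a b c => map_add (m.mul a) b c
    right_distrib := fun a b c => LinearMap.map_add₂ m.mul a b c
    zero_mul := fun a => LinearMap.map_zero₂ m.mul a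
    mul_zero := fun a => map_zero (m.mul a) }

instance (m : AlgebraStructure V) : Algebra ℂ m.Carrier :=
  Algebra.ofModule (fun c a b => LinearMap.map_smul₂ m.mul c a b)
    (fun c a b => map_smul (m.mul a) c b)

end AlgebraStructure

namespace JordanianSeries

/-- The series `x`, as an element of the algebra with the multiplication `m`. -/
noncomputable def x (m : AlgebraStructure JordanianSeries) : m.Carrier := monomial 1 0

/-- The series `y`, as an element of the algebra with the multiplication `m`. -/
noncomputable def y (m : AlgebraStructure JordanianSeries) : m.Carrier := monomial 0 1

/-- The (separately) continuous algebra multiplications on the space of power series for which the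
monomial `xⁱ yʲ` is the product of the `i`-th power of `x` and the `j`-th power of `y`, and for
which `yx = xy + y²`. -/
structure IsJordanianMul (m : AlgebraStructure JordanianSeries) : Prop where
  continuous_mul_left : ∀ a : m.Carrier, Continuous fun b : m.Carrier => a * b
  continuous_mul_right : ∀ b : m.Carrier, Continuous fun a : m.Carrier => a * b
  pow_mul_pow : ∀ i j : ℕ, x m ^ i * y m ^ j = (monomial i j : m.Carrier)
  relation : y m * x m = x m * y m + y m ^ 2

end JordanianSeries

universe u

/-!
Write `V` for the space of series. Each `‖·‖_ρ` is a weighted `ℓ¹`-norm, and `V` is a complete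
locally convex space in which every `a` is the sum of the `a_{ij} xⁱ yʲ`. Hence a continuous linear
map on `V` is determined by its values on the monomials (`continuousLinear_ext`), its continuity
estimates may be checked there (`seminorm_le_of_monomial`), and a family `v_{ij}` in a complete
locally convex space extends to a continuous linear map as soon as every seminorm of `v_{ij}` is
dominated by some multiple of `ρ^{i+j} / j!` (`exists_extension`). All maps below arise in this way.

*The multiplication.* The relation gives `yʲ x = x yʲ + j yʲ⁺¹`, so right multiplication by `x` and
by `y` must be the operators `X : xⁱ yʲ ↦ xⁱ⁺¹ yʲ + j xⁱ yʲ⁺¹` and `Y : xⁱ yʲ ↦ xⁱ yʲ⁺¹`, and the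
product must be `a b = ∑ b_{kn} Yⁿ Xᵏ a`; this is uniqueness. Conversely,
`‖X a‖_ρ ≤ 2ρ ‖a‖_ρ` and `‖Yⁿ a‖_ρ ≤ ρⁿ / n! ‖a‖_ρ`, so that this series converges and
`‖a b‖_ρ ≤ ‖a‖_ρ ‖b‖_{2ρ}` (`seminorm_mulBilin_le`). The product is associative since
`b ↦ a b` commutes with `X` and `Y` (`mulBilin_rightX`, `mulBilin_rightY`), which is a consequence
of `X Yⁿ = Yⁿ X + n Yⁿ⁺¹`.

*Submultiplicative seminorms.* The operator norm `N_ρ(b)` of `a ↦ a b` with respect to `‖·‖_ρ` is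
submultiplicative, and `‖b‖_ρ ≤ N_ρ(b) ≤ ‖b‖_{2ρ}`, so the `N_ρ` generate the topology.

*The universal property.* If `yx = xy + y²` in an algebra with a submultiplicative seminorm `p`, then
`(j + 1) yʲ⁺² = [yʲ⁺¹, x]` gives `p(yʲ⁺¹) ≤ p(y) (2 p(x))ʲ / j!`, so that `p(xⁱ yʲ)` is dominated by
a multiple of some `ρ^{i+j} / j!` (`Seminorm.exists_map_pow_mul_pow_le`). Therefore every
homomorphism from the Jordanian plane to an Arens-Michael algebra extends to `V`.
-/

open Filter Topology

namespace JordanianSeries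

/-! ### The topological vector space of power series -/

instance : IsTopologicalAddGroup JordanianSeries := withSeminorms.topologicalAddGroup

instance : ContinuousSMul ℂ JordanianSeries := withSeminorms.continuousSMul

@[ext]
theorem ext {a b : JordanianSeries} (h : ∀ n, a.coeff n = b.coeff n) : a = b :=
  Subtype.ext (funext h)

@[simp] theorem coeff_sub (a b : JordanianSeries) : (a - b).coeff = a.coeff - b.coeff := rfl

/-- The coefficient of index `n`, as a linear functional. -/
def coeffLinear (n : ℕ × ℕ) : JordanianSeries →ₗ[ℂ] ℂ where
  toFun a := a.coeff n
  map_add' _ _ := rfl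
  map_smul' _ _ := rfl

theorem seminorm_apply (ρ : Set.Ioi (0 : ℝ)) (a : JordanianSeries) :
    seminorm ρ a = ∑' n, jordanianTerm ρ a.coeff n := rfl

theorem summable_jordanianTerm (ρ : Set.Ioi (0 : ℝ)) (a : JordanianSeries) :
    Summable (jordanianTerm ρ a.coeff) := a.2 ρ ρ.2

theorem coeff_monomial (n k : ℕ × ℕ) :
    (monomial n.1 n.2).coeff k = if k = n then 1 else 0 := by
  simp [monomial, coeff, Pi.single_apply]

theorem seminorm_monomial (ρ : Set.Ioi (0 : ℝ)) (i j : ℕ) :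
    seminorm ρ (monomial i j) = (ρ : ℝ) ^ (i + j) / (j.factorial : ℝ) := by
  rw [seminorm_apply, tsum_eq_single (i, j)]
  · simp [jordanianTerm, coeff_monomial (i, j)]
  · intro n hn
    simp [jordanianTerm, coeff_monomial (i, j), hn]

theorem jordanianTerm_eq (ρ : Set.Ioi (0 : ℝ)) (a : JordanianSeries) (n : ℕ × ℕ) :
    jordanianTerm ρ a.coeff n = ‖a.coeff n‖ * seminorm ρ (monomial n.1 n.2) := by
  rw [seminorm_monomial, jordanianTerm]

theorem norm_coeff_le (n : ℕ × ℕ) (a : JordanianSeries) :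
    ‖a.coeff n‖ ≤ (n.2.factorial : ℝ) * seminorm ⟨1, Set.mem_Ioi.2 one_pos⟩ a := by
  have h := (summable_jordanianTerm ⟨1, Set.mem_Ioi.2 one_pos⟩ a).le_tsum n
    fun k _ => jordanianTerm_nonneg one_pos _ k
  rw [← seminorm_apply] at h
  simp only [jordanianTerm, one_pow] at h
  rw [mul_one_div, div_le_iff₀ (by positivity)] at h
  linarith

theorem continuous_coeff (n : ℕ × ℕ) : Continuous (coeffLinear n) := by
  refine WithSeminorms.continuous_of_isBounded (q := fun _ : Fin 1 => normSeminorm ℂ ℂ) withSeminorms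
    (norm_withSeminorms ℂ ℂ) _ fun _ => ⟨{⟨1, Set.mem_Ioi.2 one_pos⟩}, n.2.factorial, fun a => ?_⟩
  rw [Finset.sup_singleton]
  exact norm_coeff_le n a

instance : T2Space JordanianSeries := by
  refine T2Space.of_injective_continuous (f := fun a n => coeffLinear n a) (fun a b h => ?_)
    (continuous_pi continuous_coeff)
  exact ext fun n => congrFun h n

/-- A Cauchy filter converges coefficientwise; a bound for finite partial sums of `‖a - b‖_ρ`,
with `a` and `b` in a small set of the filter, passes to the coefficientwise limit, which therefore
lies in the space and is the limit of the filter. -/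
theorem completeSpace :
    @CompleteSpace JordanianSeries (IsTopologicalAddGroup.rightUniformSpace JordanianSeries) := by
  let : UniformSpace JordanianSeries := IsTopologicalAddGroup.rightUniformSpace JordanianSeries
  have : IsUniformAddGroup JordanianSeries := isUniformAddGroup_of_addCommGroup
  refine ⟨fun {F} hF => ?_⟩
  have := hF.1
  have hlim : ∀ n, ∃ c, Tendsto (fun a : JordanianSeries => a.coeff n) F (𝓝 c) := fun n =>
    CompleteSpace.complete (hF.map (uniformContinuous_addMonoidHom_of_continuous
      (f := (coeffLinear n).toAddMonoidHom) (continuous_coeff n)))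
  choose c hc using hlim
  have hsmall : ∀ (ρ : Set.Ioi (0 : ℝ)) (ε : ℝ), 0 < ε →
      ∃ S ∈ F, ∀ a ∈ S, ∀ b ∈ S, seminorm ρ (b - a) < ε := by
    intro ρ ε hε
    have h0 : {a | seminorm ρ a < ε} ∈ 𝓝 (0 : JordanianSeries) := by
      have := (withSeminorms.continuous_seminorm ρ).tendsto 0
      rw [map_zero] at this
      exact this.eventually_lt_const hε
    have h1 : {p : JordanianSeries × JordanianSeries | seminorm ρ (p.2 - p.1) < ε}
        ∈ uniformity JordanianSeries := by
      rw [uniformity_eq_comap_nhds_zero]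
      exact ⟨_, h0, fun p hp => hp⟩
    obtain ⟨S, hS, h⟩ := (cauchy_iff.1 hF).2 _ h1
    exact ⟨S, hS, fun a ha b hb => h (Set.mk_mem_prod ha hb)⟩
  have hclose : ∀ (ρ : Set.Ioi (0 : ℝ)) (ε : ℝ), 0 < ε →
      ∃ S ∈ F, ∀ a ∈ S, Summable (jordanianTerm ρ (c - a.coeff)) ∧
        ∑' n, jordanianTerm ρ (c - a.coeff) n ≤ ε := by
    intro ρ ε hε
    obtain ⟨S, hS, h⟩ := hsmall ρ ε hε
    refine ⟨S, hS, fun a ha => ?_⟩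
    have hfin : ∀ s : Finset (ℕ × ℕ), ∑ n ∈ s, jordanianTerm ρ (c - a.coeff) n ≤ ε := by
      intro s
      have ht : Tendsto (fun b : JordanianSeries => ∑ n ∈ s, jordanianTerm ρ (b - a).coeff n) F
          (𝓝 (∑ n ∈ s, jordanianTerm ρ (c - a.coeff) n)) := by
        refine tendsto_finsetSum _ fun n _ => ?_
        exact (((hc n).sub_const _).norm).mul_const _
      refine le_of_tendsto ht (Filter.mem_of_superset hS fun b hb => ?_)
      exact ((summable_jordanianTerm ρ (b - a)).sum_le_tsum s
        fun n _ => jordanianTerm_nonneg ρ.2 _ n).trans (h a ha b hb).le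
    have hs := summable_of_sum_le (jordanianTerm_nonneg ρ.2 (c - a.coeff)) hfin
    exact ⟨hs, hs.tsum_le_of_sum_le hfin⟩
  have hmem : c ∈ jordanianSubmodule := by
    intro ρ hρ
    obtain ⟨S, hS, h⟩ := hclose ⟨ρ, hρ⟩ 1 one_pos
    obtain ⟨a, ha⟩ := hF.1.nonempty_of_mem hS
    have := (h a ha).1.add (summable_jordanianTerm ⟨ρ, hρ⟩ a)
    refine Summable.of_nonneg_of_le (jordanianTerm_nonneg hρ _) (fun n => ?_) this
    simpa using jordanianTerm_add_le hρ (c - a.coeff) a.coeff n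
  let l : JordanianSeries := ⟨c, hmem⟩
  refine ⟨l, ?_⟩
  refine (withSeminorms.tendsto_nhds (id : JordanianSeries → JordanianSeries) _).2
    fun ρ ε hε => ?_
  obtain ⟨S, hS, h⟩ := hclose ρ (ε / 2) (half_pos hε)
  refine Filter.mem_of_superset hS fun a ha => ?_
  change seminorm ρ (a - l) < ε
  rw [map_sub_rev]
  exact (h a ha).2.trans_lt (half_lt_self hε)

/-! ### Extension of linear maps from the monomials -/

section Extension

variable {W : Type*} [AddCommGroup W] [Module ℂ W] [TopologicalSpace W]

theorem hasSum_monomial (a : JordanianSeries) :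
    HasSum (fun n : ℕ × ℕ => a.coeff n • monomial n.1 n.2) a := by
  refine (withSeminorms.tendsto_nhds _ _).2 fun ρ ε hε => ?_
  have h := (tendsto_tsum_compl_atTop_zero (jordanianTerm ρ a.coeff)).eventually_lt_const hε
  filter_upwards [h] with s hs
  refine lt_of_eq_of_lt ?_ hs
  have hind := tsum_subtype {n | n ∉ s} (jordanianTerm ρ a.coeff)
  refine Eq.trans ?_ hind.symm
  rw [map_sub_rev, seminorm_apply]
  refine tsum_congr fun n => ?_
  have hsum : (∑ k ∈ s, a.coeff k • monomial k.1 k.2).coeff n = if n ∈ s then a.coeff n else 0 := by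
    change coeffLinear n _ = _
    rw [map_sum]
    have : ∀ k, coeffLinear n (a.coeff k • monomial k.1 k.2) = if n = k then a.coeff k else 0 := by
      intro k
      rw [map_smul]
      change _ • (monomial k.1 k.2).coeff n = _
      simp [coeff_monomial]
    simp [this]
  by_cases hn : n ∈ s <;> simp [jordanianTerm, hsum, hn]

/-- A continuous linear map is determined by its values on the monomials. -/
theorem continuousLinear_ext [T2Space W] {f g : JordanianSeries →ₗ[ℂ] W} (hf : Continuous f)
    (hg : Continuous g) (h : ∀ i j, f (monomial i j) = g (monomial i j)) : f = g := by
  refine LinearMap.ext fun a => ?_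
  have h1 := (hasSum_monomial a).map f hf
  have h2 := (hasSum_monomial a).map g hg
  refine h1.unique ?_
  have h3 : f ∘ (fun n : ℕ × ℕ => a.coeff n • monomial n.1 n.2) =
      g ∘ fun n : ℕ × ℕ => a.coeff n • monomial n.1 n.2 := by
    ext n
    simp [h]
  rwa [h3]

theorem _root_.Seminorm.le_tsum_of_hasSum {p : Seminorm ℂ W} (hp : Continuous p) {κ : Type*}
    {f : κ → W} {w : W} (hf : HasSum f w) {g : κ → ℝ} (hg : Summable g)
    (h : ∀ k, p (f k) ≤ g k) : p w ≤ ∑' k, g k := by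
  have ht : Tendsto (fun s : Finset κ => p (∑ k ∈ s, f k)) atTop (𝓝 (p w)) :=
    (hp.tendsto _).comp hf
  refine le_of_tendsto ht (Eventually.of_forall fun s => ?_)
  calc p (∑ k ∈ s, f k) ≤ ∑ k ∈ s, p (f k) :=
        Finset.le_sum_of_subadditive p (map_zero p).le (map_add_le_add p) _ _
    _ ≤ ∑ k ∈ s, g k := Finset.sum_le_sum fun k _ => h k
    _ ≤ ∑' k, g k := hg.sum_le_tsum s fun k _ => (apply_nonneg p _).trans (h k)

/-- Since `‖·‖_ρ` is a weighted `ℓ¹`-norm, an estimate for a seminorm against `‖·‖_ρ` may be checked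
on the monomials. -/
theorem seminorm_le_of_monomial {p : Seminorm ℂ W} (hp : Continuous p)
    {f : JordanianSeries →ₗ[ℂ] W} (hf : Continuous f) {C : ℝ} {ρ : Set.Ioi (0 : ℝ)}
    (h : ∀ i j, p (f (monomial i j)) ≤ C * seminorm ρ (monomial i j)) (a : JordanianSeries) :
    p (f a) ≤ C * seminorm ρ a := by
  rw [seminorm_apply, ← tsum_mul_left]
  refine Seminorm.le_tsum_of_hasSum hp ((hasSum_monomial a).map f hf)
    ((summable_jordanianTerm ρ a).mul_left C) fun n => ?_
  rw [Function.comp_apply, map_smul, map_smul_eq_mul, jordanianTerm_eq]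
  calc ‖a.coeff n‖ * p (f (monomial n.1 n.2))
      ≤ ‖a.coeff n‖ * (C * seminorm ρ (monomial n.1 n.2)) := by gcongr; exact h _ _
    _ = _ := by ring

theorem summable_of_summable_seminorm [IsTopologicalAddGroup W]
    (hW : @CompleteSpace W (IsTopologicalAddGroup.rightUniformSpace W))
    {ι κ : Type*} {P : SeminormFamily ℂ W ι} (hP : WithSeminorms P) {f : κ → W}
    (hf : ∀ i, Summable fun k => P i (f k)) : Summable f := by
  let : UniformSpace W := IsTopologicalAddGroup.rightUniformSpace W
  have : IsUniformAddGroup W := isUniformAddGroup_of_addCommGroup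
  have : CompleteSpace W := hW
  rw [summable_iff_vanishing]
  intro e he
  obtain ⟨⟨I, r⟩, hr, hsub⟩ := hP.hasBasis_zero_ball.mem_iff.1 he
  have hI : Summable fun k => ∑ i ∈ I, P i (f k) := summable_sum fun i _ => hf i
  obtain ⟨s, hs⟩ := summable_iff_vanishing_norm.1 hI r hr
  refine ⟨s, fun t ht => hsub ?_⟩
  rw [Seminorm.mem_ball_zero]
  refine Seminorm.finset_sup_apply_lt hr fun i hi => ?_
  calc P i (∑ k ∈ t, f k) ≤ ∑ k ∈ t, P i (f k) :=
        Finset.le_sum_of_subadditive (P i) (map_zero (P i)).le (map_add_le_add _) _ _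
    _ ≤ ∑ k ∈ t, ∑ i ∈ I, P i (f k) := Finset.sum_le_sum fun k _ =>
        Finset.single_le_sum (f := fun i => P i (f k)) (fun i _ => apply_nonneg _ _) hi
    _ ≤ ‖∑ k ∈ t, ∑ i ∈ I, P i (f k)‖ := le_abs_self _
    _ < r := hs t ht

/-- A family of vectors of a complete locally convex space is the image of the monomials under a
continuous linear map, provided that each seminorm of the family is dominated by some `‖·‖_ρ` on
the monomials. -/
theorem exists_extension [T2Space W] [IsTopologicalAddGroup W]
    (hW : @CompleteSpace W (IsTopologicalAddGroup.rightUniformSpace W))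
    {ι : Type*} {P : SeminormFamily ℂ W ι} (hP : WithSeminorms P) (v : ℕ → ℕ → W)
    (hv : ∀ i, ∃ (C : ℝ) (ρ : Set.Ioi (0 : ℝ)), ∀ k n, P i (v k n) ≤ C * seminorm ρ (monomial k n)) :
    ∃ T : JordanianSeries →ₗ[ℂ] W, Continuous T ∧ ∀ k n, T (monomial k n) = v k n := by
  have := hP.continuousSMul
  choose C ρ hC using hv
  have hterm : ∀ i (a : JordanianSeries) (n : ℕ × ℕ),
      P i (a.coeff n • v n.1 n.2) ≤ C i * jordanianTerm (ρ i) a.coeff n := by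
    intro i a n
    rw [map_smul_eq_mul, jordanianTerm_eq]
    calc ‖a.coeff n‖ * P i (v n.1 n.2)
        ≤ ‖a.coeff n‖ * (C i * seminorm (ρ i) (monomial n.1 n.2)) := by gcongr; exact hC _ _ _
      _ = _ := by ring
  have hsum : ∀ a : JordanianSeries, Summable fun n : ℕ × ℕ => a.coeff n • v n.1 n.2 := fun a =>
    summable_of_summable_seminorm hW hP fun i => Summable.of_nonneg_of_le
      (fun n => apply_nonneg _ _) (hterm i a) ((summable_jordanianTerm (ρ i) a).mul_left (C i))
  let T : JordanianSeries →ₗ[ℂ] W :=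
    { toFun := fun a => ∑' n : ℕ × ℕ, a.coeff n • v n.1 n.2
      map_add' := fun a b => by
        rw [← (hsum a).tsum_add (hsum b)]
        exact tsum_congr fun n => add_smul _ _ _
      map_smul' := fun c a => by
        rw [RingHom.id_apply, ← (hsum a).tsum_const_smul c]
        exact tsum_congr fun n => mul_smul _ _ _ }
  have hbound : ∀ i a, P i (T a) ≤ C i * seminorm (ρ i) a := by
    intro i a
    rw [seminorm_apply, ← tsum_mul_left]
    exact Seminorm.le_tsum_of_hasSum (hP.continuous_seminorm i) (hsum a).hasSum
      ((summable_jordanianTerm (ρ i) a).mul_left (C i)) (hterm i a)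
  refine ⟨T, WithSeminorms.continuous_of_isBounded withSeminorms hP T fun i =>
    ⟨{ρ i}, (C i).toNNReal, fun a => ?_⟩, fun k n => ?_⟩
  · rw [Finset.sup_singleton, Seminorm.comp_apply, smul_apply, NNReal.smul_def,
      smul_eq_mul, Real.coe_toNNReal']
    exact (hbound i a).trans (mul_le_mul_of_nonneg_right (le_max_left _ _) (apply_nonneg _ _))
  · change ∑' m : ℕ × ℕ, (monomial k n).coeff m • v m.1 m.2 = v k n
    rw [tsum_eq_single (k, n) fun m hm => by simp [coeff_monomial (k, n), hm]]
    simp [coeff_monomial (k, n)]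

end Extension

/-! ### Right multiplication by the generators -/

theorem seminorm_monomial_add_le (ρ : Set.Ioi (0 : ℝ)) (i j : ℕ) :
    seminorm ρ (monomial (i + 1) j + (j : ℂ) • monomial i (j + 1)) ≤
      2 * ρ * seminorm ρ (monomial i j) := by
  have hρ : (0 : ℝ) < ρ := ρ.2
  refine (map_add_le_add _ _ _).trans ?_
  rw [map_smul_eq_mul, seminorm_monomial, seminorm_monomial, seminorm_monomial,
    Complex.norm_natCast]
  have h : (j : ℝ) / ((j + 1).factorial : ℝ) ≤ 1 / (j.factorial : ℝ) := by
    rw [Nat.factorial_succ, Nat.cast_mul, div_le_div_iff₀ (by positivity) (by positivity)]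
    push_cast
    nlinarith [show (0 : ℝ) < j.factorial by positivity]
  calc (ρ : ℝ) ^ (i + 1 + j) / (j.factorial : ℝ)
        + j * ((ρ : ℝ) ^ (i + (j + 1)) / ((j + 1).factorial : ℝ))
      = (ρ : ℝ) ^ (i + j + 1) * (1 / (j.factorial : ℝ))
        + (ρ : ℝ) ^ (i + j + 1) * (j / ((j + 1).factorial : ℝ)) := by
          rw [show i + 1 + j = i + j + 1 by ring, show i + (j + 1) = i + j + 1 by ring]; ring
    _ ≤ (ρ : ℝ) ^ (i + j + 1) * (1 / (j.factorial : ℝ))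
        + (ρ : ℝ) ^ (i + j + 1) * (1 / (j.factorial : ℝ)) := by gcongr
    _ = 2 * ρ * ((ρ : ℝ) ^ (i + j) / (j.factorial : ℝ)) := by ring

theorem exists_rightX : ∃ T : JordanianSeries →ₗ[ℂ] JordanianSeries, Continuous T ∧
    ∀ i j, T (monomial i j) = monomial (i + 1) j + (j : ℂ) • monomial i (j + 1) := by
  exact exists_extension completeSpace withSeminorms _ fun ρ =>
    ⟨2 * ρ, ρ, seminorm_monomial_add_le ρ⟩

theorem exists_rightY : ∃ T : JordanianSeries →ₗ[ℂ] JordanianSeries, Continuous T ∧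
    ∀ i j, T (monomial i j) = monomial i (j + 1) := by
  refine exists_extension completeSpace withSeminorms _ fun ρ => ⟨ρ, ρ, fun i j => ?_⟩
  have hρ : (0 : ℝ) < ρ := ρ.2
  rw [seminorm_monomial, seminorm_monomial, ← mul_div_assoc,
    show (ρ : ℝ) * (ρ : ℝ) ^ (i + j) = (ρ : ℝ) ^ (i + (j + 1)) by ring]
  gcongr
  exact Nat.le_succ j

/-- The right multiplication by `x`: in view of `[yʲ, x] = j yʲ⁺¹`, it is the continuous linear map
`xⁱ yʲ ↦ xⁱ⁺¹ yʲ + j xⁱ yʲ⁺¹`. -/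
noncomputable def rightX : JordanianSeries →ₗ[ℂ] JordanianSeries := exists_rightX.choose

/-- The right multiplication by `y`: the continuous linear map `xⁱ yʲ ↦ xⁱ yʲ⁺¹`. -/
noncomputable def rightY : JordanianSeries →ₗ[ℂ] JordanianSeries := exists_rightY.choose

theorem continuous_rightX : Continuous rightX := exists_rightX.choose_spec.1

theorem continuous_rightY : Continuous rightY := exists_rightY.choose_spec.1

@[simp] theorem rightX_monomial (i j : ℕ) :
    rightX (monomial i j) = monomial (i + 1) j + (j : ℂ) • monomial i (j + 1) :=
  exists_rightX.choose_spec.2 i j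

@[simp] theorem rightY_monomial (i j : ℕ) : rightY (monomial i j) = monomial i (j + 1) :=
  exists_rightY.choose_spec.2 i j

theorem continuous_pow {T : JordanianSeries →ₗ[ℂ] JordanianSeries} (hT : Continuous T) (n : ℕ) :
    Continuous (T ^ n) := by
  rw [Module.End.coe_pow]
  exact hT.iterate n

theorem rightY_pow_monomial (n i j : ℕ) : (rightY ^ n) (monomial i j) = monomial i (j + n) := by
  induction n with
  | zero => rfl
  | succ n ih => rw [pow_succ', Module.End.mul_apply, ih, rightY_monomial, add_assoc]

theorem rightX_pow_monomial_zero (k i : ℕ) :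
    (rightX ^ k) (monomial i 0) = monomial (i + k) 0 := by
  induction k with
  | zero => rfl
  | succ k ih => rw [pow_succ', Module.End.mul_apply, ih, rightX_monomial]; simp [add_assoc]

theorem seminorm_rightX_pow_le (ρ : Set.Ioi (0 : ℝ)) (k : ℕ) (a : JordanianSeries) :
    seminorm ρ ((rightX ^ k) a) ≤ (2 * ρ) ^ k * seminorm ρ a := by
  have hρ : (0 : ℝ) < ρ := ρ.2
  induction k with
  | zero => simp
  | succ k ih =>
    have h : ∀ b, seminorm ρ (rightX b) ≤ 2 * ρ * seminorm ρ b := by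
      refine seminorm_le_of_monomial (withSeminorms.continuous_seminorm ρ) continuous_rightX
        fun i j => ?_
      rw [rightX_monomial]
      exact seminorm_monomial_add_le ρ i j
    rw [pow_succ', Module.End.mul_apply, pow_succ', mul_assoc]
    exact (h _).trans (by gcongr)

/-- The factorial in this estimate is the reason for the factorials in the seminorms `‖·‖_ρ`. -/
theorem seminorm_rightY_pow_le (ρ : Set.Ioi (0 : ℝ)) (n : ℕ) (a : JordanianSeries) :
    seminorm ρ ((rightY ^ n) a) ≤ (ρ : ℝ) ^ n / (n.factorial : ℝ) * seminorm ρ a := by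
  have hρ : (0 : ℝ) < ρ := ρ.2
  refine seminorm_le_of_monomial (withSeminorms.continuous_seminorm ρ)
    (continuous_pow continuous_rightY n) (fun i j => ?_) a
  rw [rightY_pow_monomial, seminorm_monomial, seminorm_monomial, div_mul_div_comm,
    show (ρ : ℝ) ^ n * (ρ : ℝ) ^ (i + j) = (ρ : ℝ) ^ (i + (j + n)) by ring]
  gcongr
  rw [mul_comm]
  exact_mod_cast Nat.le_of_dvd (Nat.factorial_pos _)
    (Nat.factorial_mul_factorial_dvd_factorial_add j n)

theorem seminorm_pow_pow_le (ρ σ : Set.Ioi (0 : ℝ)) (h : (σ : ℝ) = 2 * ρ) (k n : ℕ)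
    (a : JordanianSeries) : seminorm ρ ((rightY ^ n) ((rightX ^ k) a)) ≤
      seminorm ρ a * seminorm σ (monomial k n) := by
  have hρ : (0 : ℝ) < ρ := ρ.2
  calc seminorm ρ ((rightY ^ n) ((rightX ^ k) a))
      ≤ (ρ : ℝ) ^ n / (n.factorial : ℝ) * ((2 * ρ) ^ k * seminorm ρ a) :=
        (seminorm_rightY_pow_le ρ n _).trans (by gcongr; exact seminorm_rightX_pow_le ρ k a)
    _ ≤ (2 * ρ : ℝ) ^ n / (n.factorial : ℝ) * ((2 * ρ) ^ k * seminorm ρ a) := by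
        gcongr; linarith
    _ = seminorm ρ a * seminorm σ (monomial k n) := by
        rw [seminorm_monomial, h]; ring

theorem rightX_rightY (a : JordanianSeries) :
    rightX (rightY a) = rightY (rightX a) + rightY (rightY a) := by
  have h : rightX ∘ₗ rightY = rightY ∘ₗ rightX + rightY ∘ₗ rightY := by
    refine continuousLinear_ext (continuous_rightX.comp continuous_rightY)
      ((continuous_rightY.comp continuous_rightX).add
        (continuous_rightY.comp continuous_rightY)) fun i j => ?_
    simp only [LinearMap.comp_apply, LinearMap.add_apply, rightX_monomial, rightY_monomial,
      map_add, map_smul]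
    push_cast
    module
  exact LinearMap.congr_fun h a

theorem rightX_rightY_pow (n : ℕ) (a : JordanianSeries) : rightX ((rightY ^ n) a) =
    (rightY ^ n) (rightX a) + (n : ℂ) • (rightY ^ (n + 1)) a := by
  induction n with
  | zero => simp
  | succ n ih =>
    rw [pow_succ', Module.End.mul_apply, rightX_rightY, ih, pow_succ' rightY (n + 1),
      pow_succ' rightY n]
    simp only [Module.End.mul_apply, map_add, map_smul]
    push_cast
    module

/-! ### The multiplication -/

theorem exists_mulLeft (a : JordanianSeries) :
    ∃ T : JordanianSeries →ₗ[ℂ] JordanianSeries, Continuous T ∧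
      ∀ k n, T (monomial k n) = (rightY ^ n) ((rightX ^ k) a) :=
  exists_extension completeSpace withSeminorms _ fun ρ =>
    ⟨seminorm ρ a, ⟨2 * ρ, Set.mem_Ioi.2 (mul_pos two_pos ρ.2)⟩,
      fun k n => seminorm_pow_pow_le ρ _ rfl k n a⟩

/-- The left multiplication `b ↦ a b`, determined by `a xᵏ yⁿ = Rʸⁿ (Rˣᵏ a)`, where `Rˣ` and `Rʸ`
are the right multiplications by `x` and by `y`. -/
noncomputable def mulLeft (a : JordanianSeries) : JordanianSeries →ₗ[ℂ] JordanianSeries :=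
  (exists_mulLeft a).choose

theorem continuous_mulLeft (a : JordanianSeries) : Continuous (mulLeft a) :=
  (exists_mulLeft a).choose_spec.1

@[simp] theorem mulLeft_monomial (a : JordanianSeries) (k n : ℕ) :
    mulLeft a (monomial k n) = (rightY ^ n) ((rightX ^ k) a) :=
  (exists_mulLeft a).choose_spec.2 k n

/-- The multiplication of power series. -/
noncomputable def mulBilin : JordanianSeries →ₗ[ℂ] JordanianSeries →ₗ[ℂ] JordanianSeries where
  toFun := mulLeft
  map_add' a b := continuousLinear_ext (continuous_mulLeft _)
    ((continuous_mulLeft a).add (continuous_mulLeft b)) fun k n => by simp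
  map_smul' c a := continuousLinear_ext (continuous_mulLeft _)
    ((continuous_mulLeft a).const_smul c) fun k n => by simp

@[simp] theorem mulBilin_monomial (a : JordanianSeries) (k n : ℕ) :
    mulBilin a (monomial k n) = (rightY ^ n) ((rightX ^ k) a) := mulLeft_monomial a k n

theorem continuous_mulBilin_right (a : JordanianSeries) : Continuous (mulBilin a) :=
  continuous_mulLeft a

theorem seminorm_mulBilin_le (ρ σ : Set.Ioi (0 : ℝ)) (h : (σ : ℝ) = 2 * ρ)
    (a b : JordanianSeries) : seminorm ρ (mulBilin a b) ≤ seminorm ρ a * seminorm σ b :=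
  seminorm_le_of_monomial (withSeminorms.continuous_seminorm ρ) (continuous_mulBilin_right a)
    (fun k n => by rw [mulBilin_monomial]; exact seminorm_pow_pow_le ρ σ h k n a) b

theorem continuous_mulBilin_left (b : JordanianSeries) : Continuous fun a => mulBilin a b := by
  refine WithSeminorms.continuous_of_isBounded withSeminorms withSeminorms (mulBilin.flip b)
    fun ρ => ⟨{ρ}, (seminorm ⟨2 * ρ, Set.mem_Ioi.2 (mul_pos two_pos ρ.2)⟩ b).toNNReal, fun a => ?_⟩
  rw [Finset.sup_singleton, Seminorm.comp_apply, smul_apply, NNReal.smul_def,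
    smul_eq_mul, Real.coe_toNNReal _ (apply_nonneg _ _), mul_comm]
  exact seminorm_mulBilin_le ρ _ rfl a b

/-- As `xᵏ yⁿ x = xᵏ⁺¹ yⁿ + n xᵏ yⁿ⁺¹`, this amounts to the commutation rule for `rightX` and the
powers of `rightY`. Together with `mulBilin_rightY` it yields associativity. -/
theorem mulBilin_rightX (a b : JordanianSeries) :
    mulBilin a (rightX b) = rightX (mulBilin a b) := by
  have h : mulBilin a ∘ₗ rightX = rightX ∘ₗ mulBilin a := by
    refine continuousLinear_ext ((continuous_mulBilin_right a).comp continuous_rightX)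
      (continuous_rightX.comp (continuous_mulBilin_right a)) fun k n => ?_
    simp only [LinearMap.comp_apply, rightX_monomial, map_add, map_smul, mulBilin_monomial,
      rightX_rightY_pow]
    rw [pow_succ' rightX k, Module.End.mul_apply]
  exact LinearMap.congr_fun h b

theorem mulBilin_rightY (a b : JordanianSeries) :
    mulBilin a (rightY b) = rightY (mulBilin a b) := by
  have h : mulBilin a ∘ₗ rightY = rightY ∘ₗ mulBilin a := by
    refine continuousLinear_ext ((continuous_mulBilin_right a).comp continuous_rightY)
      (continuous_rightY.comp (continuous_mulBilin_right a)) fun k n => ?_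
    simp only [LinearMap.comp_apply, rightY_monomial, mulBilin_monomial]
    rw [pow_succ' rightY n, Module.End.mul_apply]
  exact LinearMap.congr_fun h b

theorem mulBilin_rightY_pow_rightX_pow (a b : JordanianSeries) (k n : ℕ) :
    mulBilin a ((rightY ^ n) ((rightX ^ k) b)) = (rightY ^ n) ((rightX ^ k) (mulBilin a b)) := by
  induction n with
  | zero =>
    induction k with
    | zero => rfl
    | succ k ih =>
      simp only [pow_zero, Module.End.one_apply, pow_succ', Module.End.mul_apply] at ih ⊢
      rw [mulBilin_rightX, ih]
  | succ n ih =>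
    rw [pow_succ', Module.End.mul_apply, mulBilin_rightY, ih, Module.End.mul_apply]

theorem mulBilin_assoc (a b c : JordanianSeries) :
    mulBilin (mulBilin a b) c = mulBilin a (mulBilin b c) := by
  have h : mulBilin (mulBilin a b) = mulBilin a ∘ₗ mulBilin b := by
    refine continuousLinear_ext (continuous_mulBilin_right _)
      ((continuous_mulBilin_right a).comp (continuous_mulBilin_right b)) fun k n => ?_
    simp [mulBilin_rightY_pow_rightX_pow]
  exact LinearMap.congr_fun h c

/-- The algebra structure on the space of power series. -/
noncomputable def algebraStructure : AlgebraStructure JordanianSeries where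
  mul := mulBilin
  one := monomial 0 0
  mul_assoc := mulBilin_assoc
  one_mul b := by
    have h : mulBilin (monomial 0 0) = LinearMap.id := by
      refine continuousLinear_ext (continuous_mulBilin_right _) continuous_id fun k n => ?_
      simp [rightX_pow_monomial_zero, rightY_pow_monomial]
    exact LinearMap.congr_fun h b
  mul_one a := by simp

theorem pow_mul_pow_algebraStructure (i j : ℕ) :
    x algebraStructure ^ i * y algebraStructure ^ j =
      (monomial i j : algebraStructure.Carrier) := by
  have hx : ∀ i, x algebraStructure ^ i = (monomial i 0 : algebraStructure.Carrier) := by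
    intro i
    induction i with
    | zero => rfl
    | succ i ih =>
      rw [pow_succ, ih]
      change mulBilin (monomial i 0) (monomial 1 0) = monomial (i + 1) 0
      simp
  have hy : ∀ j, y algebraStructure ^ j = (monomial 0 j : algebraStructure.Carrier) := by
    intro j
    induction j with
    | zero => rfl
    | succ j ih =>
      rw [pow_succ, ih]
      change mulBilin (monomial 0 j) (monomial 0 1) = monomial 0 (j + 1)
      simp
  rw [hx, hy]
  change mulBilin (monomial i 0) (monomial 0 j) = monomial i j
  simp [rightY_pow_monomial]

theorem isJordanianMul_algebraStructure : IsJordanianMul algebraStructure where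
  continuous_mul_left := continuous_mulBilin_right
  continuous_mul_right := continuous_mulBilin_left
  pow_mul_pow := pow_mul_pow_algebraStructure
  relation := by
    rw [pow_two]
    change mulBilin (monomial 0 1) (monomial 1 0) =
      mulBilin (monomial 1 0) (monomial 0 1) + mulBilin (monomial 0 1) (monomial 0 1)
    simp

end JordanianSeries

/-! ### Uniqueness of the multiplication -/

/-- The commutation rule `yʲ x = x yʲ + j yʲ⁺¹` in any algebra with `yx = xy + y²`. -/
theorem pow_mul_of_mul_eq {R : Type*} [Ring R] {x y : R}
    (h : y * x = x * y + y ^ 2) (j : ℕ) : y ^ j * x = x * y ^ j + j * y ^ (j + 1) := by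
  induction j with
  | zero => simp
  | succ j ih =>
    calc y ^ (j + 1) * x = y * (y ^ j * x) := by rw [pow_succ', mul_assoc]
      _ = (y * x) * y ^ j + j * y ^ (j + 2) := by
          rw [ih, mul_add, ← mul_assoc, ← mul_assoc, ← Nat.cast_comm, mul_assoc _ y, ← pow_succ']
      _ = x * y ^ (j + 1) + (y ^ (j + 2) + j * y ^ (j + 2)) := by
          rw [h, add_mul, mul_assoc, ← pow_succ', ← pow_add, add_comm 2 j, add_assoc]
      _ = x * y ^ (j + 1) + ((j + 1 : ℕ) : R) * y ^ (j + 1 + 1) := by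
          push_cast; rw [add_mul, one_mul, add_comm (y ^ (j + 2))]

theorem pow_mul_pow_mul_of_mul_eq {R : Type*} [Ring R] [Algebra ℂ R] {x y : R}
    (h : y * x = x * y + y ^ 2) (i j : ℕ) :
    x ^ i * y ^ j * x = x ^ (i + 1) * y ^ j + (j : ℂ) • (x ^ i * y ^ (j + 1)) := by
  rw [mul_assoc, pow_mul_of_mul_eq h, mul_add, ← mul_assoc, ← pow_succ,
    Nat.cast_smul_eq_nsmul, nsmul_eq_mul, ← mul_assoc, ← mul_assoc, Nat.cast_comm]

namespace JordanianSeries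

/-- The relation and the powers of `x` and `y` force the right multiplications by `x` and `y` on the
monomials, hence everywhere. -/
theorem IsJordanianMul.eq_algebraStructure {m : AlgebraStructure JordanianSeries}
    (hm : IsJordanianMul m) : m = algebraStructure := by
  have hX : ∀ a : JordanianSeries, m.mul a (monomial 1 0) = rightX a := by
    have h : m.mul.flip (monomial 1 0) = rightX := by
      have hc : Continuous fun a : JordanianSeries => m.mul a (monomial 1 0) :=
        hm.continuous_mul_right (monomial 1 0 : JordanianSeries)
      refine continuousLinear_ext hc continuous_rightX fun i j => ?_
      rw [rightX_monomial]
      have h1 := pow_mul_pow_mul_of_mul_eq hm.relation i j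
      rw [hm.pow_mul_pow, hm.pow_mul_pow, hm.pow_mul_pow] at h1
      exact h1
    exact LinearMap.congr_fun h
  have hY : ∀ a : JordanianSeries, m.mul a (monomial 0 1) = rightY a := by
    have h : m.mul.flip (monomial 0 1) = rightY := by
      have hc : Continuous fun a : JordanianSeries => m.mul a (monomial 0 1) :=
        hm.continuous_mul_right (monomial 0 1 : JordanianSeries)
      refine continuousLinear_ext hc continuous_rightY fun i j => ?_
      rw [rightY_monomial]
      have h1 : x m ^ i * y m ^ j * y m = x m ^ i * y m ^ (j + 1) := by
        rw [mul_assoc, ← pow_succ]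
      rw [hm.pow_mul_pow, hm.pow_mul_pow] at h1
      exact h1
    exact LinearMap.congr_fun h
  have hpow : ∀ (k n : ℕ) (a : m.Carrier),
      a * (x m ^ k * y m ^ n) = ((rightY ^ n) ((rightX ^ k) a) : JordanianSeries) := by
    intro k n a
    induction n with
    | zero =>
      rw [pow_zero, mul_one]
      induction k with
      | zero => rw [pow_zero, mul_one]; rfl
      | succ k ih =>
        rw [pow_succ, ← mul_assoc, ih]
        refine (hX _).trans ?_
        rw [pow_succ' rightX]
        rfl
    | succ n ih =>
      rw [pow_succ, ← mul_assoc, ← mul_assoc, mul_assoc a, ih]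
      refine (hY _).trans ?_
      simp [pow_succ']
  have hmul : m.mul = mulBilin := by
    refine LinearMap.ext fun a => ?_
    have hc : Continuous fun b : JordanianSeries => m.mul a b := hm.continuous_mul_left a
    refine continuousLinear_ext hc (continuous_mulBilin_right a) fun k n => ?_
    rw [mulBilin_monomial, ← hpow k n a, hm.pow_mul_pow]
    rfl
  have hone : m.one = monomial 0 0 := by
    have h := hm.pow_mul_pow 0 0
    rw [pow_zero, pow_zero, mul_one] at h
    exact h
  exact AlgebraStructure.ext hmul hone

/-! ### The submultiplicative seminorms -/

/-- The norm of the right multiplication by `b`, as an operator for the norm `‖·‖_ρ`: the supremum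
of `‖a b‖_ρ` over all `a` with `‖a‖_ρ ≤ 1`. -/
noncomputable def opSeminorm (ρ : Set.Ioi (0 : ℝ)) : Seminorm ℂ JordanianSeries :=
  ⨆ a : {a : JordanianSeries // seminorm ρ a ≤ 1}, (seminorm ρ).comp (mulBilin a)

theorem bddAbove_opSeminorm (ρ : Set.Ioi (0 : ℝ)) : BddAbove (Set.range
    fun a : {a : JordanianSeries // seminorm ρ a ≤ 1} => (seminorm ρ).comp (mulBilin a)) := by
  refine ⟨seminorm ⟨2 * ρ, Set.mem_Ioi.2 (mul_pos two_pos ρ.2)⟩, ?_⟩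
  rintro _ ⟨a, rfl⟩ b
  exact (seminorm_mulBilin_le ρ _ rfl a b).trans
    (mul_le_of_le_one_left (apply_nonneg _ _) a.2)

instance (ρ : Set.Ioi (0 : ℝ)) : Nonempty {a : JordanianSeries // seminorm ρ a ≤ 1} :=
  ⟨⟨0, by simp⟩⟩

theorem opSeminorm_le {ρ : Set.Ioi (0 : ℝ)} {b : JordanianSeries} {C : ℝ}
    (h : ∀ a, seminorm ρ a ≤ 1 → seminorm ρ (mulBilin a b) ≤ C) : opSeminorm ρ b ≤ C := by
  rw [opSeminorm, Seminorm.iSup_apply (bddAbove_opSeminorm ρ)]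
  exact ciSup_le fun a => h a a.2

theorem seminorm_mulBilin_le_opSeminorm (ρ : Set.Ioi (0 : ℝ)) (a b : JordanianSeries) :
    seminorm ρ (mulBilin a b) ≤ seminorm ρ a * opSeminorm ρ b := by
  have hunit : ∀ a, seminorm ρ a ≤ 1 → seminorm ρ (mulBilin a b) ≤ opSeminorm ρ b :=
    fun a ha => le_ciSup (bddAbove_opSeminorm ρ) ⟨a, ha⟩ b
  rcases (apply_nonneg (seminorm ρ) a).eq_or_lt with h0 | h0
  · rw [← h0, zero_mul]
    refine (seminorm_mulBilin_le ρ ⟨2 * ρ, Set.mem_Ioi.2 (mul_pos two_pos ρ.2)⟩ rfl a b).trans ?_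
    rw [← h0, zero_mul]
  · have h := hunit (((seminorm ρ a)⁻¹ : ℂ) • a) (by
      rw [map_smul_eq_mul, norm_inv, Complex.norm_real, Real.norm_of_nonneg h0.le,
        inv_mul_cancel₀ h0.ne'])
    rw [map_smul, LinearMap.smul_apply, map_smul_eq_mul, norm_inv, Complex.norm_real,
      Real.norm_of_nonneg h0.le, inv_mul_le_iff₀ h0] at h
    exact h

theorem opSeminorm_mulBilin_le (ρ : Set.Ioi (0 : ℝ)) (b c : JordanianSeries) :
    opSeminorm ρ (mulBilin b c) ≤ opSeminorm ρ b * opSeminorm ρ c := by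
  refine opSeminorm_le fun a ha => ?_
  rw [← mulBilin_assoc]
  refine (seminorm_mulBilin_le_opSeminorm ρ _ c).trans ?_
  gcongr
  exact (seminorm_mulBilin_le_opSeminorm ρ a b).trans
    (mul_le_of_le_one_left (apply_nonneg _ _) ha)

theorem opSeminorm_le_seminorm (ρ : Set.Ioi (0 : ℝ)) :
    opSeminorm ρ ≤ seminorm ⟨2 * ρ, Set.mem_Ioi.2 (mul_pos two_pos ρ.2)⟩ := fun b =>
  opSeminorm_le fun a ha => (seminorm_mulBilin_le ρ _ rfl a b).trans
    (mul_le_of_le_one_left (apply_nonneg _ _) ha)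

theorem seminorm_le_opSeminorm (ρ : Set.Ioi (0 : ℝ)) : seminorm ρ ≤ opSeminorm ρ := fun b => by
  have h := seminorm_mulBilin_le_opSeminorm ρ (monomial 0 0) b
  rwa [seminorm_monomial, show mulBilin (monomial 0 0) b = b from algebraStructure.one_mul b,
    add_zero, pow_zero, Nat.factorial_zero, Nat.cast_one, div_one, one_mul] at h

theorem withSeminorms_opSeminorm :
    WithSeminorms fun p : Set.range opSeminorm => (p : Seminorm ℂ JordanianSeries) := by
  refine withSeminorms.congr ?_ fun ρ => ⟨{⟨_, ρ, rfl⟩}, 1, ?_⟩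
  · rintro ⟨_, ρ, rfl⟩
    refine ⟨{⟨2 * ρ, Set.mem_Ioi.2 (mul_pos two_pos ρ.2)⟩}, 1, ?_⟩
    rw [Finset.sup_singleton, one_smul]
    exact opSeminorm_le_seminorm ρ
  · rw [Finset.sup_singleton, one_smul]
    exact seminorm_le_opSeminorm ρ

theorem isArensMichaelAlgebra : IsArensMichaelAlgebra algebraStructure.Carrier where
  isTopologicalAddGroup := inferInstanceAs (IsTopologicalAddGroup JordanianSeries)
  t2Space := inferInstanceAs (T2Space JordanianSeries)
  completeSpace := completeSpace
  exists_seminorms := by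
    refine ⟨Set.range opSeminorm, ?_, withSeminorms_opSeminorm⟩
    rintro _ ⟨ρ, rfl⟩ a b
    exact opSeminorm_mulBilin_le ρ a b

end JordanianSeries

/-! ### Homomorphisms into Arens-Michael algebras -/

section Submultiplicative

variable {B : Type*} [Ring B] [Algebra ℂ B] {p : Seminorm ℂ B}

theorem Seminorm.map_pow_le_of_submultiplicative (hp : ∀ a b, p (a * b) ≤ p a * p b) (a : B)
    (k : ℕ) : p (a ^ k) ≤ p 1 * p a ^ k := by
  induction k with
  | zero => simp
  | succ k ih =>
    rw [pow_succ, pow_succ, ← mul_assoc]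
    exact (hp _ _).trans (by gcongr)

/-- The identity `(j + 1) yʲ⁺² = [yʲ⁺¹, x]` makes the powers of `y` decay factorially in each
submultiplicative seminorm. -/
theorem Seminorm.map_pow_succ_le_of_mul_eq (hp : ∀ a b, p (a * b) ≤ p a * p b) {x y : B}
    (h : y * x = x * y + y ^ 2) (j : ℕ) :
    p (y ^ (j + 1)) ≤ p y * (2 * p x) ^ j / (j.factorial : ℝ) := by
  induction j with
  | zero => simp
  | succ j ih =>
    have h1 : ((j + 1 : ℕ) : ℂ) • y ^ (j + 2) = y ^ (j + 1) * x - x * y ^ (j + 1) := by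
      rw [pow_mul_of_mul_eq h, Nat.cast_smul_eq_nsmul, nsmul_eq_mul, add_sub_cancel_left]
    have h2 : ((j + 1 : ℕ) : ℝ) * p (y ^ (j + 2)) ≤ 2 * p x * p (y ^ (j + 1)) := by
      rw [← Complex.norm_natCast, ← map_smul_eq_mul, h1]
      calc p (y ^ (j + 1) * x - x * y ^ (j + 1))
          ≤ p (y ^ (j + 1) * x) + p (x * y ^ (j + 1)) := map_sub_le_add p _ _
        _ ≤ p (y ^ (j + 1)) * p x + p x * p (y ^ (j + 1)) := add_le_add (hp _ _) (hp _ _)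
        _ = 2 * p x * p (y ^ (j + 1)) := by ring
    have hx := apply_nonneg p x
    rw [Nat.factorial_succ, Nat.cast_mul, le_div_iff₀ (by positivity)]
    calc p (y ^ (j + 1 + 1)) * (((j + 1 : ℕ) : ℝ) * (j.factorial : ℝ))
        = ((j + 1 : ℕ) : ℝ) * p (y ^ (j + 2)) * (j.factorial : ℝ) := by ring
      _ ≤ 2 * p x * p (y ^ (j + 1)) * (j.factorial : ℝ) := by gcongr
      _ ≤ 2 * p x * (p y * (2 * p x) ^ j / (j.factorial : ℝ)) * (j.factorial : ℝ) := by gcongr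
      _ = p y * (2 * p x) ^ (j + 1) := by field_simp; ring

theorem Seminorm.exists_map_pow_mul_pow_le (hp : ∀ a b, p (a * b) ≤ p a * p b) {x y : B}
    (h : y * x = x * y + y ^ 2) : ∃ (C : ℝ) (ρ : Set.Ioi (0 : ℝ)), ∀ k n,
      p (x ^ k * y ^ n) ≤ C * JordanianSeries.seminorm ρ (JordanianSeries.monomial k n) := by
  have hx := apply_nonneg p x
  have hy := apply_nonneg p y
  have h1 := apply_nonneg p 1
  obtain ⟨r, hr, hxr, hyr⟩ : ∃ r, 0 < r ∧ p x ≤ r ∧ p y ≤ r :=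
    ⟨p x + p y + 1, by positivity, by linarith, by linarith⟩
  have hxk : ∀ k, p (x ^ k) ≤ (p 1 + 1) * (4 * r) ^ k := fun k =>
    (Seminorm.map_pow_le_of_submultiplicative hp x k).trans (by gcongr <;> linarith)
  have hyn : ∀ n, p (y ^ n) ≤ (p 1 + 1) * ((4 * r) ^ n / (n.factorial : ℝ)) := by
    rintro (_ | j)
    · simp
    · refine (Seminorm.map_pow_succ_le_of_mul_eq hp h j).trans ?_
      have h2 : ((j + 1 : ℕ) : ℝ) ≤ 2 ^ (j + 1) := by exact_mod_cast Nat.lt_two_pow_self.le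
      calc p y * (2 * p x) ^ j / (j.factorial : ℝ)
          ≤ r * (2 * r) ^ j / (j.factorial : ℝ) := by gcongr
        _ ≤ (2 * r) * (2 * r) ^ j / (j.factorial : ℝ) := by gcongr; linarith
        -- The factor `j + 1` turns `j!` into `(j + 1)!` and costs at most `2 ^ (j + 1)`.
        _ = ((j + 1 : ℕ) : ℝ) * ((2 * r) ^ (j + 1) / ((j + 1).factorial : ℝ)) := by
            rw [Nat.factorial_succ, Nat.cast_mul]; field_simp; ring
        _ ≤ 2 ^ (j + 1) * ((2 * r) ^ (j + 1) / ((j + 1).factorial : ℝ)) := by gcongr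
        _ = 1 * ((4 * r) ^ (j + 1) / ((j + 1).factorial : ℝ)) := by
            rw [show 4 * r = 2 * (2 * r) by ring, mul_pow 2 (2 * r)]; ring
        _ ≤ _ := by gcongr; linarith
  refine ⟨(p 1 + 1) ^ 2, ⟨4 * r, Set.mem_Ioi.2 (by positivity)⟩, fun k n => ?_⟩
  rw [JordanianSeries.seminorm_monomial]
  calc p (x ^ k * y ^ n) ≤ p (x ^ k) * p (y ^ n) := hp _ _
    _ ≤ ((p 1 + 1) * (4 * r) ^ k) * ((p 1 + 1) * ((4 * r) ^ n / (n.factorial : ℝ))) :=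
        mul_le_mul (hxk k) (hyn n) (apply_nonneg _ _) (by positivity)
    _ = _ := by rw [pow_add]; ring

end Submultiplicative

section Envelope

variable {B : Type*} [Ring B] [Algebra ℂ B] [TopologicalSpace B]

theorem IsArensMichaelAlgebra.continuous_mul_left (hB : IsArensMichaelAlgebra B) (a : B) :
    Continuous fun b : B => a * b := by
  obtain ⟨P, hP, hW⟩ := hB.exists_seminorms
  refine WithSeminorms.continuous_of_isBounded hW hW (LinearMap.mulLeft ℂ a)
    fun p => ⟨{p}, (p.1 a).toNNReal, fun b => ?_⟩
  rw [Finset.sup_singleton, Seminorm.comp_apply, smul_apply, NNReal.smul_def, smul_eq_mul,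
    Real.coe_toNNReal _ (apply_nonneg _ _)]
  exact hP p p.2 a b

theorem IsArensMichaelAlgebra.continuous_mul_right (hB : IsArensMichaelAlgebra B) (b : B) :
    Continuous fun a : B => a * b := by
  obtain ⟨P, hP, hW⟩ := hB.exists_seminorms
  refine WithSeminorms.continuous_of_isBounded hW hW (LinearMap.mulRight ℂ b)
    fun p => ⟨{p}, (p.1 b).toNNReal, fun a => ?_⟩
  rw [Finset.sup_singleton, Seminorm.comp_apply, smul_apply, NNReal.smul_def, smul_eq_mul,
    Real.coe_toNNReal _ (apply_nonneg _ _), mul_comm]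
  exact hP p p.2 a b

namespace JordanianSeries

/-- The homomorphism is the continuous extension of `xᵏ yⁿ ↦ Xᵏ Yⁿ`. It intertwines the right
multiplications by `x` and `y` with those by `X` and `Y`, and is therefore multiplicative. -/
theorem exists_continuous_algHom (hB : IsArensMichaelAlgebra B) {X Y : B}
    (h : Y * X = X * Y + Y ^ 2) : ∃ ψ : algebraStructure.Carrier →ₐ[ℂ] B,
      Continuous ψ ∧ ψ (x algebraStructure) = X ∧ ψ (y algebraStructure) = Y := by
  have := hB.isTopologicalAddGroup
  have := hB.t2Space
  obtain ⟨P, hP, hW⟩ := hB.exists_seminorms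
  obtain ⟨T, hT, hTm⟩ := exists_extension hB.completeSpace hW (fun k n => X ^ k * Y ^ n)
    fun p => Seminorm.exists_map_pow_mul_pow_le (hP p p.2) h
  have hTX : ∀ a, T (rightX a) = T a * X := by
    have h1 : T ∘ₗ rightX = LinearMap.mulRight ℂ X ∘ₗ T := by
      refine continuousLinear_ext (hT.comp continuous_rightX)
        ((hB.continuous_mul_right X).comp hT) fun i j => ?_
      simp only [LinearMap.comp_apply, rightX_monomial, map_add, map_smul, hTm,
        LinearMap.mulRight_apply, pow_mul_pow_mul_of_mul_eq h]
    exact LinearMap.congr_fun h1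
  have hTY : ∀ a, T (rightY a) = T a * Y := by
    have h1 : T ∘ₗ rightY = LinearMap.mulRight ℂ Y ∘ₗ T := by
      refine continuousLinear_ext (hT.comp continuous_rightY)
        ((hB.continuous_mul_right Y).comp hT) fun i j => ?_
      simp only [LinearMap.comp_apply, rightY_monomial, hTm, LinearMap.mulRight_apply]
      rw [pow_succ, mul_assoc]
    exact LinearMap.congr_fun h1
  have hTpow : ∀ a k n, T ((rightY ^ n) ((rightX ^ k) a)) = T a * (X ^ k * Y ^ n) := by
    intro a k n
    induction n with
    | zero =>
      induction k with
      | zero => simp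
      | succ k ih =>
        simp only [pow_zero, Module.End.one_apply, mul_one] at ih ⊢
        rw [pow_succ', Module.End.mul_apply, hTX, ih, pow_succ, mul_assoc]
    | succ n ih =>
      rw [pow_succ', Module.End.mul_apply, hTY, ih, pow_succ, mul_assoc, mul_assoc]
  have hTmul : ∀ a b, T (mulBilin a b) = T a * T b := by
    intro a
    have h1 : T ∘ₗ mulBilin a = LinearMap.mulLeft ℂ (T a) ∘ₗ T := by
      refine continuousLinear_ext (hT.comp (continuous_mulBilin_right a))
        ((hB.continuous_mul_left (T a)).comp hT) fun k n => ?_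
      simp only [LinearMap.comp_apply, mulBilin_monomial, hTm, LinearMap.mulLeft_apply, hTpow]
    exact LinearMap.congr_fun h1
  have hTone : T (monomial 0 0) = 1 := by simp [hTm]
  let T' : algebraStructure.Carrier →ₗ[ℂ] B := T
  refine ⟨AlgHom.ofLinearMap T' hTone hTmul, hT, (hTm 1 0).trans ?_, (hTm 0 1).trans ?_⟩ <;> simp

theorem algHom_ext_of_continuous [T2Space B] {ψ₁ ψ₂ : algebraStructure.Carrier →ₐ[ℂ] B}
    (h₁ : Continuous ψ₁) (h₂ : Continuous ψ₂)
    (hx : ψ₁ (x algebraStructure) = ψ₂ (x algebraStructure))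
    (hy : ψ₁ (y algebraStructure) = ψ₂ (y algebraStructure)) : ψ₁ = ψ₂ := by
  let f₁ : JordanianSeries →ₗ[ℂ] B := ψ₁.toLinearMap
  let f₂ : JordanianSeries →ₗ[ℂ] B := ψ₂.toLinearMap
  have h : f₁ = f₂ := by
    refine continuousLinear_ext h₁ h₂ fun i j => ?_
    change ψ₁ (monomial i j : algebraStructure.Carrier) =
      ψ₂ (monomial i j : algebraStructure.Carrier)
    rw [← pow_mul_pow_algebraStructure, map_mul, map_mul, map_pow, map_pow, map_pow, map_pow,
      hx, hy]
  exact AlgHom.ext fun a => LinearMap.congr_fun h a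

end JordanianSeries

namespace JordanianPlane

theorem relation : y * x = x * y + y ^ 2 := by
  have h := RingQuot.mkAlgHom_rel ℂ JordanianRel.rel
  rw [map_sub, map_sub, map_mul, map_mul, map_pow, map_zero, sub_sub, sub_eq_zero] at h
  exact h

theorem algHom_ext {A : Type*} [Ring A] [Algebra ℂ A] {f g : JordanianPlane →ₐ[ℂ] A}
    (hx : f x = g x) (hy : f y = g y) : f = g := by
  refine RingQuot.ringQuot_ext' (S := ℂ) f g (FreeAlgebra.hom_ext (funext fun i => ?_))
  fin_cases i
  exacts [hx, hy]

theorem exists_algHom {A : Type*} [Ring A] [Algebra ℂ A] {X Y : A} (h : Y * X = X * Y + Y ^ 2) :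
    ∃ f : JordanianPlane →ₐ[ℂ] A, f x = X ∧ f y = Y := by
  refine ⟨RingQuot.liftAlgHom ℂ ⟨FreeAlgebra.lift ℂ ![X, Y], ?_⟩, ?_, ?_⟩
  · rintro _ _ ⟨⟩
    simp [h]
  · simp [x]
  · simp [y]

end JordanianPlane

/-- The topology induced by a linear map into a locally convex space is one of those whose supremum
is the strongest locally convex topology. -/
theorem continuous_strongestLocallyConvexTopology {V W : Type*} [AddCommGroup V] [Module ℂ V]
    [AddCommGroup W] [Module ℂ W] [t : TopologicalSpace W] [IsTopologicalAddGroup W]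
    [ContinuousSMul ℂ W] [LocallyConvexSpace ℝ W] (f : V →ₗ[ℂ] W) :
    @Continuous V W (strongestLocallyConvexTopology V) t f := by
  rw [continuous_iff_le_induced]
  exact sInf_le ⟨topologicalAddGroup_induced f, ContinuousSMul.induced f,
    LocallyConvexSpace.induced (f.restrictScalars ℝ)⟩

theorem isArensMichaelEnvelope_of_map_generators
    (ι : JordanianPlane →ₐ[ℂ] JordanianSeries.algebraStructure.Carrier)
    (hx : ι JordanianPlane.x = JordanianSeries.x _)
    (hy : ι JordanianPlane.y = JordanianSeries.y _) : IsArensMichaelEnvelope.{u} ι := by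
  let : TopologicalSpace JordanianPlane := strongestLocallyConvexTopology JordanianPlane
  refine ⟨JordanianSeries.isArensMichaelAlgebra, ?_, fun B _ _ _ hB φ _ => ?_⟩
  · have : LocallyConvexSpace ℝ JordanianSeries :=
      JordanianSeries.withSeminorms.toLocallyConvexSpace
    let f : JordanianPlane →ₗ[ℂ] JordanianSeries := ι.toLinearMap
    exact continuous_strongestLocallyConvexTopology f
  · have := hB.t2Space
    have hrel : φ JordanianPlane.y * φ JordanianPlane.x =
        φ JordanianPlane.x * φ JordanianPlane.y + φ JordanianPlane.y ^ 2 := by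
      simp only [← map_mul, ← map_pow, ← map_add, JordanianPlane.relation]
    obtain ⟨ψ, hψ, hψx, hψy⟩ := JordanianSeries.exists_continuous_algHom hB hrel
    refine ⟨ψ, ⟨hψ, JordanianPlane.algHom_ext ?_ ?_⟩, fun ψ' ⟨hψ', h'⟩ => ?_⟩
    · rw [AlgHom.comp_apply, hx, hψx]
    · rw [AlgHom.comp_apply, hy, hψy]
    · refine JordanianSeries.algHom_ext_of_continuous hψ' hψ ?_ ?_
      · rw [hψx, ← hx, ← h', AlgHom.comp_apply]
      · rw [hψy, ← hy, ← h', AlgHom.comp_apply]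

end Envelope

/-- There is exactly one multiplication on the space of power series `∑ a_{ij} xⁱ yʲ` that is
continuous and satisfies `yx = xy + y²`; every element is the sum of its power series; and the
resulting topological algebra, with the homomorphism `x ↦ x`, `y ↦ y`, is the Arens-Michael
envelope of the Jordanian plane. -/
theorem mainTheorem1 :
    ∃ m : AlgebraStructure JordanianSeries,
      JordanianSeries.IsJordanianMul m ∧
      (∀ m' : AlgebraStructure JordanianSeries, JordanianSeries.IsJordanianMul m' → m' = m) ∧
      (∀ a : JordanianSeries, HasSum
        (fun n : ℕ × ℕ => a.coeff n • (JordanianSeries.x m ^ n.1 * JordanianSeries.y m ^ n.2))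
        (a : m.Carrier)) ∧
      ∃ ι : JordanianPlane →ₐ[ℂ] m.Carrier,
        ι JordanianPlane.x = JordanianSeries.x m ∧
        ι JordanianPlane.y = JordanianSeries.y m ∧
        IsArensMichaelEnvelope.{u} ι := by
  have hm := JordanianSeries.isJordanianMul_algebraStructure
  refine ⟨JordanianSeries.algebraStructure, hm, fun m' hm' => hm'.eq_algebraStructure,
    fun a => ?_, ?_⟩
  · simp only [hm.pow_mul_pow]
    exact JordanianSeries.hasSum_monomial a
  · obtain ⟨ι, hx, hy⟩ := JordanianPlane.exists_algHom hm.relation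
    exact ⟨ι, hx, hy, isArensMichaelEnvelope_of_map_generators ι hx hy⟩
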